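/- Let $E$ be a Euclidean space of finite dimension $d\ge 2$, let $m_1,\dots,m_N>0$ be masses, and equip $E^N$ with the mass inner product $\langle x,y\rangle=\sum_i m_i\langle x_i,y_i\rangle_E$, with norm $\|\cdot\|$ and dual norm also written $\|\cdot\|$. Let $\Omega=\{x\in E^N : x_i\ne x_j \text{ for } i\neq j\}$, $U(x)=\sum_{i<j}m_im_j\|x_i-x_j\|_E^{-1}$ (equal to $+\infty$ off $\Omega$), $L(x,v)=\tfrac12\|v\|^2+U(x)$ and $H(x,p)=\tfrac12\|p\|^2-U(x)$ (so $L=+\infty$ and $H=-\infty$ off $\Omega$). Fix $a\in\Omega$ and put $h=\tfrac12\|a\|^2$. Let $u:E^N\to\mathbb R$ be a continuous viscosity subsolution of $H(x,d_xu)=h$, i.e. $H(x,d_x\varphi)\le h$ whenever $\varphi$ is $C^1$ and $u-\varphi$ has a local maximum at $x$. A calibrating curve of $u$ is a curve $\gamma:(-\infty,0]\to E^N$, absolutely continuous on compact intervals, such that $u(\gamma(t))-u(\gamma(s))=\int_s^t \big(L(\gamma,\dot\gamma)+h\big)\,d\tau$ for all $s\le t\le 0$. Denote by $\mathscr S_a$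 the set of all such $u$ (the hyperbolic viscosity solutions with limit shape $a$) for which (1) for every $x\in E^N$ there is at least one calibrating curve $\gamma$ of $u$ with $\gamma(0)=x$; (2) for every calibrating curve $\gamma$ of $u$, the reversed curve $y(t)=\gamma(-t)$ is a hyperbolic motion with limit shape $a$: for $t>0$ it stays in $\Omega$ and solves Newton's equations $\ddot y=\nabla U(y)$ (gradient with respect to the mass inner product), and $y(t)=ta+o(t)$ as $t\to+\infty$. Theorem. If $u_1,u_2\in\mathscr S_a$, then there is $k\in\mathbb R$ such that $u_2(x)=u_1(x)+k$ for all $x\in E^N$. -/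

import Mathlib

open Filter Topology MeasureTheory

noncomputable section

namespace NBody

variable {E : Type*} [NormedAddCommGroup E] [InnerProductSpace ℝ E] {N : ℕ}

/-- The configurations without collisions, `Ω ⊆ E ^ N`. -/
def collisionFree (E : Type*) (N : ℕ) : Set (Fin N → E) :=
  {x | ∀ i j, i ≠ j → x i ≠ x j}

/-- The square of the norm of `E ^ N` given by the mass inner product
`⟪x, y⟫ = ∑ i, m i * ⟪x i, y i⟫`. -/
def massNormSq (m : Fin N → ℝ) (v : Fin N → E) : ℝ :=
  ∑ i, m i * ‖v i‖ ^ 2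

/-- The norm on linear forms on `E ^ N` dual to the mass norm, i.e. the supremum of `p v` over the
vectors `v` of mass norm at most one. -/
def massDualNorm (m : Fin N → ℝ) (p : (Fin N → E) →L[ℝ] ℝ) : ℝ :=
  sSup {c | ∃ v : Fin N → E, massNormSq m v ≤ 1 ∧ c = p v}

/-- The Newtonian potential `U x = ∑_{i < j} m i * m j / ‖x i - x j‖`; for positive masses it is
`∞` exactly at the configurations with collisions. -/
def potential (m : Fin N → ℝ) (x : Fin N → E) : ENNReal :=
  ∑ i, ∑ j ∈ Finset.Ioi i, ENNReal.ofReal (m i * m j) / ENNReal.ofReal ‖x i - x j‖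

/-- The Lagrangian `L (x, v) = ‖v‖² / 2 + U x`, equal to `+∞` at collisions. -/
def lagrangian (m : Fin N → ℝ) (x v : Fin N → E) : ENNReal :=
  ENNReal.ofReal (massNormSq m v / 2) + potential m x

/-- The Hamiltonian `H (x, p) = ‖p‖² / 2 - U x`, equal to `-∞` at collisions. -/
def hamiltonian (m : Fin N → ℝ) (x : Fin N → E) (p : (Fin N → E) →L[ℝ] ℝ) : EReal :=
  ((massDualNorm m p ^ 2 / 2 : ℝ) : EReal) - ((potential m x : ENNReal) : EReal)

/-- The action of `L + h` (for `h ≥ 0`) along the restriction of `γ` to `[s, t]`. -/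
def action (m : Fin N → ℝ) (h : ℝ) (γ : ℝ → Fin N → E) (s t : ℝ) : ENNReal :=
  ∫⁻ τ in Set.Icc s t, (lagrangian m (γ τ) (deriv γ τ) + ENNReal.ofReal h)

/-- `u` is a viscosity subsolution of `H (x, d_x u) = h` on `E ^ N`. -/
def IsViscositySubsolution (m : Fin N → ℝ) (h : ℝ) (u : (Fin N → E) → ℝ) : Prop :=
  ∀ φ : (Fin N → E) → ℝ, ContDiff ℝ 1 φ → ∀ x : Fin N → E,
    IsLocalMax (fun y => u y - φ y) x → hamiltonian m x (fderiv ℝ φ x) ≤ (h : EReal)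

/-- The restriction of `γ` to `(-∞, 0]` is a calibrating curve of `u` at the energy level `h`: it is
absolutely continuous on compact intervals `[s, t]`, and on each of them the increment of `u` is the
action of `L + h`. The values of `γ` at positive times are irrelevant. -/
def IsCalibrating (m : Fin N → ℝ) (h : ℝ) (u : (Fin N → E) → ℝ) (γ : ℝ → Fin N → E) : Prop :=
  ∀ s t : ℝ, s ≤ t → t ≤ 0 →
    AbsolutelyContinuousOnInterval γ s t ∧
      ((u (γ t) - u (γ s) : ℝ) : EReal) = ((action m h γ s t : ENNReal) : EReal)

/-- The right hand side of Newton's equations `x'' = ∇ U (x)`, the gradient being taken with respect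
to the mass inner product: the acceleration of the `i`-th body is
`∑_{j ≠ i} m j * (x j - x i) / ‖x j - x i‖ ^ 3`. -/
def newtonField (m : Fin N → ℝ) (x : Fin N → E) : Fin N → E :=
  fun i => ∑ j ∈ Finset.univ.erase i, (m j / ‖x j - x i‖ ^ 3) • (x j - x i)

/-- On the open half-line `(t₀, ∞)` the curve `x` is a hyperbolic motion with limit shape `b`: it
takes values in the configurations without collisions, solves Newton's equations, and satisfies
`x t = t b + o(t)` as `t → ∞`, where `b` has no collisions. -/
def IsHyperbolicMotion (m : Fin N → ℝ) (t₀ : ℝ) (x : ℝ → Fin N → E) (b : Fin N → E) : Prop :=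
  b ∈ collisionFree E N ∧
  (∀ t, t₀ < t → x t ∈ collisionFree E N ∧ DifferentiableAt ℝ x t ∧
    HasDerivAt (deriv x) (newtonField m (x t)) t) ∧
  (fun t => x t - t • b) =o[atTop] (fun t : ℝ => t)

/-- `u` is a hyperbolic viscosity solution of `H (x, d_x u) = h` for which `b` is the common
limit shape of all calibrating curves. A calibrating curve may end at a configuration with
collisions, so that the time reversed curve is required to be a motion at times `t > 0`. -/
structure IsHyperbolicSolutionWithShape (m : Fin N → ℝ) (h : ℝ) (b : Fin N → E)
    (u : (Fin N → E) → ℝ) : Prop where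
  continuous : Continuous u
  subsolution : IsViscositySubsolution m h u
  exists_calibrating : ∀ x : Fin N → E, ∃ γ : ℝ → Fin N → E, γ 0 = x ∧ IsCalibrating m h u γ
  hyperbolic : ∀ γ : ℝ → Fin N → E, IsCalibrating m h u γ →
    IsHyperbolicMotion m 0 (fun t => γ (-t)) b

/-- The set `𝒮_a` of hyperbolic viscosity solutions of `H (x, d_x u) = ‖a‖² / 2` all of whose
calibrating curves have limit shape `a`. -/
def solutionSet (m : Fin N → ℝ) (a : Fin N → E) : Set ((Fin N → E) → ℝ) :=
  {u | IsHyperbolicSolutionWithShape m (massNormSq m a / 2) a u}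

end NBody

end

/-!
Two solutions `u₁`, `u₂` with limit shape `a` differ by a constant because `w = u₂ - u₁` is monotone
along calibrating curves, and the curves of both solutions are asymptotically the same.

Let `y₁`, `y₂` be the time reversals of a calibrating curve of `u₁` ending at `x` and of one of `u₂`
ending at `x'`. A viscosity subsolution grows along every smooth collision-free curve at most by the
action of `L + h` (`IsViscositySubsolution.sub_le_of_hasDerivAt`), with equality along calibrating
curves. Hence `w x ≤ w (y₁ t)` and `w (y₂ t) ≤ w x'` for all `t > 0`
(`IsCalibratedRay.sub_le_sub`).

It remains to see that `w (y₁ t) - w (y₂ t)` has a nonpositive limit (it is at least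
`w x - w x'`). Put `δ = y₁ t - y₂ t`, which is `o(t)`. Adding to `y₂` a multiple of `δ` that
decreases linearly from `1` to `0` on `[t, t + T]` gives a competitor starting at `y₁ t`. The gradient
of `U` is `O(s⁻²)` near `s • a`, so that letting `T → ∞` yields
`u₂ (y₁ t) - u₂ (y₂ t) ≤ -⟪a, δ⟫ + O(‖δ‖ / t)` (`IsCalibratedRay.exists_sub_le`). The same estimate
for `u₁` and `y₁`, with `-δ` in place of `δ`, has the opposite first-order term, and the sum is
`w (y₁ t) - w (y₂ t) ≤ O(‖δ‖ / t)`, which tends to `0`. Thus `w x ≤ w x'` for all `x`, `x'`.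

Domination is needed only along smooth curves in the open set `Ω`, and is obtained from an upper
bound of the Dini derivative of `u` along the curve. That bound comes from testing the subsolution
with smooth approximations of a cone (`IsViscositySubsolution.exists_eventually_sub_le`).
-/

set_option linter.unusedSectionVars false

namespace NBody

section

variable {E : Type*} [NormedAddCommGroup E] [InnerProductSpace ℝ E] {N : ℕ}

/-! ### The mass inner product and its dual norm -/

/-- The mass inner product `⟪x, y⟫ = ∑ i, m i * ⟪x i, y i⟫` on `E ^ N`. -/
noncomputable def massInner (m : Fin N → ℝ) (v w : Fin N → E) : ℝ :=
  ∑ i, m i * inner ℝ (v i) (w i)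

lemma massNormSq_nonneg {m : Fin N → ℝ} (hm : ∀ i, 0 < m i) (v : Fin N → E) :
    0 ≤ massNormSq m v :=
  Finset.sum_nonneg fun i _ => mul_nonneg (hm i).le (sq_nonneg _)

@[simp] lemma massNormSq_zero (m : Fin N → ℝ) : massNormSq m (0 : Fin N → E) = 0 := by
  simp [massNormSq]

lemma massNormSq_smul (m : Fin N → ℝ) (c : ℝ) (v : Fin N → E) :
    massNormSq m (c • v) = c ^ 2 * massNormSq m v := by
  simp only [massNormSq, Finset.mul_sum, Pi.smul_apply, norm_smul, mul_pow, Real.norm_eq_abs,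
    sq_abs]
  exact Finset.sum_congr rfl fun i _ => by ring

lemma massNormSq_add_smul (m : Fin N → ℝ) (c : ℝ) (v w : Fin N → E) :
    massNormSq m (v + c • w)
      = massNormSq m v + 2 * c * massInner m v w + c ^ 2 * massNormSq m w := by
  simp only [massNormSq, massInner, Finset.mul_sum, ← Finset.sum_add_distrib]
  refine Finset.sum_congr rfl fun i _ => ?_
  rw [Pi.add_apply, Pi.smul_apply, norm_add_sq_real, inner_smul_right, norm_smul, mul_pow,
    Real.norm_eq_abs, sq_abs]
  ring

lemma massInner_smul_left (m : Fin N → ℝ) (c : ℝ) (v w : Fin N → E) :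
    massInner m (c • v) w = c * massInner m v w := by
  simp only [massInner, Finset.mul_sum, Pi.smul_apply, real_inner_smul_left]
  exact Finset.sum_congr rfl fun i _ => by ring

lemma massInner_sub_left (m : Fin N → ℝ) (v v' w : Fin N → E) :
    massInner m (v - v') w = massInner m v w - massInner m v' w := by
  simp only [massInner, ← Finset.sum_sub_distrib, Pi.sub_apply, inner_sub_left]
  exact Finset.sum_congr rfl fun i _ => by ring

lemma massInner_neg_right (m : Fin N → ℝ) (v w : Fin N → E) :
    massInner m v (-w) = -massInner m v w := by
  simp [massInner]

lemma continuous_massInner_left (m : Fin N → ℝ) (w : Fin N → E) :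
    Continuous fun v : Fin N → E => massInner m v w := by
  unfold massInner; fun_prop

lemma hasDerivAt_massInner_left (m : Fin N → ℝ) {y : ℝ → Fin N → E} {v : Fin N → E} {r : ℝ}
    (hy : HasDerivAt y v r) (w : Fin N → E) :
    HasDerivAt (fun s => massInner m (y s) w) (massInner m v w) r := by
  unfold massInner
  refine HasDerivAt.fun_sum fun i _ => ?_
  simpa using (((hasDerivAt_pi.1 hy i).inner ℝ (hasDerivAt_const r (w i))).const_mul (m i))

lemma contDiff_massNormSq (m : Fin N → ℝ) {n : WithTop ℕ∞} :
    ContDiff ℝ n (massNormSq m : (Fin N → E) → ℝ) := by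
  unfold massNormSq
  exact ContDiff.sum fun i _ => contDiff_const.mul ((contDiff_apply ℝ E i).norm_sq ℝ)

lemma continuous_massNormSq (m : Fin N → ℝ) : Continuous (massNormSq m : (Fin N → E) → ℝ) :=
  (contDiff_massNormSq m (n := 0)).continuous

/-- The mass norm controls the sup norm of `E ^ N`. -/
lemma exists_norm_sq_le_massNormSq {m : Fin N → ℝ} (hm : ∀ i, 0 < m i) :
    ∃ c : ℝ, 0 < c ∧ ∀ v : Fin N → E, ‖v‖ ^ 2 ≤ c * massNormSq m v := by
  refine ⟨1 + ∑ i, (m i)⁻¹, ?_, fun v => ?_⟩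
  · have : 0 ≤ ∑ i, (m i)⁻¹ := Finset.sum_nonneg fun i _ => (inv_pos.2 (hm i)).le
    linarith
  set c := 1 + ∑ i, (m i)⁻¹ with hc
  have hc0 : 0 ≤ c * massNormSq m v :=
    mul_nonneg (by
      have : 0 ≤ ∑ i, (m i)⁻¹ := Finset.sum_nonneg fun i _ => (inv_pos.2 (hm i)).le
      linarith) (massNormSq_nonneg hm v)
  rw [← Real.sq_sqrt hc0]
  refine pow_le_pow_left₀ (norm_nonneg _) ((pi_norm_le_iff_of_nonneg (Real.sqrt_nonneg _)).2
    fun i => Real.le_sqrt_of_sq_le ?_) 2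
  have h1 : m i * ‖v i‖ ^ 2 ≤ massNormSq m v :=
    Finset.single_le_sum (f := fun i => m i * ‖v i‖ ^ 2)
      (fun i _ => mul_nonneg (hm i).le (sq_nonneg _)) (Finset.mem_univ i)
  have h2 : (m i)⁻¹ ≤ c := by
    have := Finset.single_le_sum (f := fun i => (m i)⁻¹)
      (fun i _ => (inv_pos.2 (hm i)).le) (Finset.mem_univ i)
    linarith
  calc ‖v i‖ ^ 2 = (m i)⁻¹ * (m i * ‖v i‖ ^ 2) := by
        rw [← mul_assoc, inv_mul_cancel₀ (hm i).ne', one_mul]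
    _ ≤ c * massNormSq m v :=
        mul_le_mul h2 h1 (mul_nonneg (hm i).le (sq_nonneg _)) ((inv_pos.2 (hm i)).le.trans h2)

lemma le_massDualNorm {m : Fin N → ℝ} (hm : ∀ i, 0 < m i) (p : (Fin N → E) →L[ℝ] ℝ)
    {v : Fin N → E} (hv : massNormSq m v ≤ 1) : p v ≤ massDualNorm m p := by
  obtain ⟨c, hc, h⟩ := exists_norm_sq_le_massNormSq (E := E) hm
  refine le_csSup ⟨‖p‖ * Real.sqrt c, ?_⟩ ⟨v, hv, rfl⟩
  rintro _ ⟨w, hw, rfl⟩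
  refine (le_abs_self _).trans ((p.le_opNorm w).trans ?_)
  refine mul_le_mul_of_nonneg_left (Real.le_sqrt_of_sq_le ((h w).trans ?_)) (norm_nonneg _)
  nlinarith

/-! ### The potential -/

/-- The Newtonian potential as a real-valued function; it has the junk value `0` for the terms of
colliding pairs. -/
noncomputable def realPotential (m : Fin N → ℝ) (x : Fin N → E) : ℝ :=
  ∑ i, ∑ j ∈ Finset.Ioi i, m i * m j / ‖x i - x j‖

lemma realPotential_nonneg {m : Fin N → ℝ} (hm : ∀ i, 0 < m i) (x : Fin N → E) :
    0 ≤ realPotential m x :=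
  Finset.sum_nonneg fun i _ => Finset.sum_nonneg fun j _ =>
    div_nonneg (mul_pos (hm i) (hm j)).le (norm_nonneg _)

lemma potential_eq {m : Fin N → ℝ} (hm : ∀ i, 0 < m i) {x : Fin N → E}
    (hx : x ∈ collisionFree E N) : potential m x = ENNReal.ofReal (realPotential m x) := by
  unfold potential realPotential
  have h0 : ∀ i j, 0 ≤ m i * m j / ‖x i - x j‖ := fun i j =>
    div_nonneg (mul_pos (hm i) (hm j)).le (norm_nonneg _)
  rw [ENNReal.ofReal_sum_of_nonneg fun i _ => Finset.sum_nonneg fun j _ => h0 i j]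
  refine Finset.sum_congr rfl fun i _ => ?_
  rw [ENNReal.ofReal_sum_of_nonneg fun j _ => h0 i j]
  refine Finset.sum_congr rfl fun j hj => ?_
  rw [ENNReal.ofReal_div_of_pos]
  exact norm_pos_iff.2 (sub_ne_zero.2 (hx i j (Finset.mem_Ioi.1 hj).ne))

lemma continuousAt_realPotential (m : Fin N → ℝ) {x : Fin N → E}
    (hx : x ∈ collisionFree E N) : ContinuousAt (realPotential m) x := by
  unfold realPotential
  refine tendsto_finsetSum _ fun i _ => tendsto_finsetSum _ fun j hj => ?_
  have : ‖x i - x j‖ ≠ 0 :=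
    norm_ne_zero_iff.2 (sub_ne_zero.2 (hx i j (Finset.mem_Ioi.1 hj).ne))
  exact ContinuousAt.div (by fun_prop) (by fun_prop) this

lemma isOpen_collisionFree : IsOpen (collisionFree E N) := by
  simp only [collisionFree, Set.ofPred_forall]
  refine isOpen_iInter_of_finite fun i => isOpen_iInter_of_finite fun j =>
    isOpen_iInter_of_finite fun _ => ?_
  exact isOpen_ne_fun (continuous_apply i) (continuous_apply j)

lemma exists_pos_le_norm_sub {a : Fin N → E} (ha : a ∈ collisionFree E N) :
    ∃ d : ℝ, 0 < d ∧ ∀ i j, i ≠ j → d ≤ ‖a i - a j‖ := by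
  have h : ∀ᶠ d : ℝ in 𝓝[>] 0, ∀ i j, i ≠ j → d ≤ ‖a i - a j‖ := by
    refine eventually_all.2 fun i => eventually_all.2 fun j => ?_
    by_cases hij : i = j
    · simp [hij]
    · have : 0 < ‖a i - a j‖ := norm_pos_iff.2 (sub_ne_zero.2 (ha i j hij))
      filter_upwards [nhdsWithin_le_nhds (Iio_mem_nhds this)] with d hd _ using le_of_lt hd
  obtain ⟨d, hd, hd0⟩ := (h.and self_mem_nhdsWithin).exists
  exact ⟨d, hd0, hd⟩

lemma norm_sub_ge_of_norm_sub_smul_le {a : Fin N → E} {d s : ℝ} (hs : 0 < s)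
    (hd : ∀ i j, i ≠ j → d ≤ ‖a i - a j‖) {z : Fin N → E} (hz : ‖z - s • a‖ ≤ d / 4 * s)
    {i j : Fin N} (hij : i ≠ j) : s * d / 2 ≤ ‖z i - z j‖ := by
  have h1 : ‖z i - s • a i‖ ≤ d / 4 * s := (norm_le_pi_norm (z - s • a) i).trans hz
  have h2 : ‖z j - s • a j‖ ≤ d / 4 * s := (norm_le_pi_norm (z - s • a) j).trans hz
  have h3 : ‖s • (a i - a j)‖ = s * ‖a i - a j‖ := by
    rw [norm_smul, Real.norm_of_nonneg hs.le]
  have h4 : s • (a i - a j) = (z i - z j) - (z i - s • a i) + (z j - s • a j) := by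
    rw [smul_sub]; abel
  have h5 : ‖s • (a i - a j)‖ ≤ ‖z i - z j‖ + ‖z i - s • a i‖ + ‖z j - s • a j‖ := by
    rw [h4]
    exact (norm_add_le _ _).trans (add_le_add (norm_sub_le _ _) le_rfl)
  nlinarith [hd i j hij]

/-- In a cone around the ray through `a` the potential is Lipschitz on the scale `s`, with a
constant of order `s⁻²`. -/
lemma exists_realPotential_sub_le {m : Fin N → ℝ} (hm : ∀ i, 0 < m i) {a : Fin N → E} {d : ℝ}
    (hd0 : 0 < d) (hd : ∀ i j, i ≠ j → d ≤ ‖a i - a j‖) :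
    ∃ C : ℝ, 0 ≤ C ∧ ∀ s : ℝ, 0 < s → ∀ z z' : Fin N → E, ‖z - s • a‖ ≤ d / 4 * s →
      ‖z' - s • a‖ ≤ d / 4 * s →
      realPotential m z - realPotential m z' ≤ C * ‖z - z'‖ / s ^ 2 := by
  refine ⟨∑ i, ∑ j ∈ Finset.Ioi i, m i * m j * (8 / d ^ 2),
    Finset.sum_nonneg fun i _ => Finset.sum_nonneg fun j _ =>
      mul_nonneg (mul_pos (hm i) (hm j)).le (by positivity), fun s hs z z' hz hz' => ?_⟩
  simp only [realPotential, ← Finset.sum_sub_distrib, Finset.sum_mul, Finset.sum_div]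
  refine Finset.sum_le_sum fun i _ => Finset.sum_le_sum fun j hj => ?_
  have hij : i ≠ j := (Finset.mem_Ioi.1 hj).ne
  have h1 := norm_sub_ge_of_norm_sub_smul_le hs hd hz hij
  have h2 := norm_sub_ge_of_norm_sub_smul_le hs hd hz' hij
  have hsd : 0 < s * d / 2 := by positivity
  have hA : 0 < ‖z i - z j‖ := hsd.trans_le h1
  have hB : 0 < ‖z' i - z' j‖ := hsd.trans_le h2
  have hM : 0 < m i * m j := mul_pos (hm i) (hm j)
  have h3 : ‖z' i - z' j‖ - ‖z i - z j‖ ≤ 2 * ‖z - z'‖ := by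
    have e1 : ‖(z - z') i‖ ≤ ‖z - z'‖ := norm_le_pi_norm _ i
    have e2 : ‖(z - z') j‖ ≤ ‖z - z'‖ := norm_le_pi_norm _ j
    have e3 : z' i - z' j - (z i - z j) = (z - z') j - (z - z') i := by
      simp only [Pi.sub_apply]; abel
    have e4 := norm_sub_norm_le (z' i - z' j) (z i - z j)
    rw [e3] at e4
    have e5 := norm_sub_le ((z - z') j) ((z - z') i)
    linarith
  have h4 : (s * d / 2) ^ 2 ≤ ‖z i - z j‖ * ‖z' i - z' j‖ := by
    rw [sq]; exact mul_le_mul h1 h2 hsd.le hA.le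
  calc m i * m j / ‖z i - z j‖ - m i * m j / ‖z' i - z' j‖
      = m i * m j * ((‖z' i - z' j‖ - ‖z i - z j‖) / (‖z i - z j‖ * ‖z' i - z' j‖)) := by
        field_simp
    _ ≤ m i * m j * (2 * ‖z - z'‖ / (s * d / 2) ^ 2) := by
        refine mul_le_mul_of_nonneg_left ?_ hM.le
        calc _ ≤ 2 * ‖z - z'‖ / (‖z i - z j‖ * ‖z' i - z' j‖) := by gcongr
          _ ≤ _ := by gcongr
    _ = m i * m j * (8 / d ^ 2) * ‖z - z'‖ / s ^ 2 := by
        field_simp; ring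

/-! ### Viscosity subsolutions at collision-free configurations -/

/-- A smooth approximation of `z ↦ K * ‖z - y‖ + B * ‖z - y‖ ^ 2` (mass norm), used as a test
function for viscosity subsolutions. -/
noncomputable def conicalTest (m : Fin N → ℝ) (K B ε : ℝ) (y z : Fin N → E) : ℝ :=
  K * Real.sqrt (massNormSq m (z - y) + ε ^ 2) + B * massNormSq m (z - y)

lemma contDiff_conicalTest {m : Fin N → ℝ} (hm : ∀ i, 0 < m i) (K B : ℝ) {ε : ℝ} (hε : 0 < ε)
    (y : Fin N → E) : ContDiff ℝ 1 (conicalTest m K B ε y) := by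
  have hQ : ContDiff ℝ 1 fun z : Fin N → E => massNormSq m (z - y) :=
    (contDiff_massNormSq m).comp (contDiff_id.sub contDiff_const)
  refine (contDiff_const.mul ((hQ.add contDiff_const).sqrt fun z => ?_)).add
    (contDiff_const.mul hQ)
  have := massNormSq_nonneg hm (z - y)
  positivity

/-- The radial derivative of the test function, computed along the ray from `y` through `x`. -/
lemma fderiv_conicalTest_radial {m : Fin N → ℝ} (hm : ∀ i, 0 < m i) (K B : ℝ) {ε : ℝ}
    (hε : 0 < ε) (y x : Fin N → E) :
    fderiv ℝ (conicalTest m K B ε y) x (x - y)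
      = K * (massNormSq m (x - y) / Real.sqrt (massNormSq m (x - y) + ε ^ 2))
        + B * (2 * massNormSq m (x - y)) := by
  set q := massNormSq m (x - y) with hq
  have hq0 : 0 ≤ q := massNormSq_nonneg hm _
  have hd : HasFDerivAt (conicalTest m K B ε y) (fderiv ℝ (conicalTest m K B ε y) x)
      (x + (0 : ℝ) • (x - y)) := by
    rw [zero_smul, add_zero]
    exact ((contDiff_conicalTest hm K B hε y).differentiable (by norm_num) x).hasFDerivAt
  have hl : HasDerivAt (fun t : ℝ => x + t • (x - y)) (x - y) 0 := by
    simpa using ((hasDerivAt_id (0 : ℝ)).smul_const (x - y)).const_add x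
  have h1 := hd.comp_hasDerivAt (0 : ℝ) hl
  have he : (conicalTest m K B ε y ∘ fun t : ℝ => x + t • (x - y))
      = fun t => K * Real.sqrt ((1 + t) ^ 2 * q + ε ^ 2) + B * ((1 + t) ^ 2 * q) := by
    funext t
    have : x + t • (x - y) - y = (1 + t) • (x - y) := by rw [add_smul, one_smul]; abel
    simp only [Function.comp, conicalTest, this, massNormSq_smul, hq]
  have h2 : HasDerivAt (fun t : ℝ => (1 + t) ^ 2 * q) (2 * q) 0 := by
    have := (((hasDerivAt_id (0 : ℝ)).const_add 1).pow 2).mul_const q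
    simpa using this
  have h3 : HasDerivAt (fun t => K * Real.sqrt ((1 + t) ^ 2 * q + ε ^ 2) + B * ((1 + t) ^ 2 * q))
      (K * (q / Real.sqrt (q + ε ^ 2)) + B * (2 * q)) 0 := by
    have h4 := (h2.add_const (ε ^ 2)).sqrt (by simp; positivity)
    have h5 := (h4.const_mul K).add (h2.const_mul B)
    have e0 : (1 + (0 : ℝ)) ^ 2 * q = q := by ring
    rw [e0, mul_div_mul_left _ _ two_ne_zero] at h5
    exact h5
  rw [he] at h1
  exact h1.unique h3

lemma massDualNorm_sq_le_of_hamiltonian_le {m : Fin N → ℝ} (hm : ∀ i, 0 < m i) {h : ℝ}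
    {x : Fin N → E} (hx : x ∈ collisionFree E N) {p : (Fin N → E) →L[ℝ] ℝ}
    (hp : hamiltonian m x p ≤ (h : EReal)) :
    massDualNorm m p ^ 2 / 2 ≤ h + realPotential m x := by
  rw [hamiltonian, potential_eq hm hx, EReal.coe_ennreal_ofReal,
    max_eq_left (realPotential_nonneg hm x), ← EReal.coe_sub, EReal.coe_le_coe_iff] at hp
  linarith

/-- A viscosity subsolution grows at a collision-free configuration `y` with a slope at most
`√(2 (U y + h))`, up to a quadratic error. The test function is `conicalTest` with `ε → 0`: its
gradient is too large for a subsolution except at a distance of order `ε` from `y`. -/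
lemma IsViscositySubsolution.exists_eventually_sub_le [FiniteDimensional ℝ E]
    {m : Fin N → ℝ} (hm : ∀ i, 0 < m i)
    {h : ℝ} (hh : 0 ≤ h) {u : (Fin N → E) → ℝ} (hu : Continuous u)
    (hs : IsViscositySubsolution m h u) {y : Fin N → E} (hy : y ∈ collisionFree E N) {K : ℝ}
    (hK0 : 0 < K) (hK : realPotential m y + h < K ^ 2 / 2) :
    ∃ B : ℝ, ∀ᶠ z in 𝓝 y,
      u z - u y ≤ K * Real.sqrt (massNormSq m (z - y)) + B * massNormSq m (z - y) := by
  obtain ⟨c, hc, hcQ⟩ := exists_norm_sq_le_massNormSq (E := E) hm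
  have hU0 := realPotential_nonneg hm y
  -- `K₁` leaves room between the slope of the test function and the bound of the equation
  obtain ⟨K₁, hK₁0, hK₁K, hK₁⟩ : ∃ K₁ : ℝ, 0 ≤ K₁ ∧ K₁ ^ 2 < K ^ 2 ∧
      realPotential m y + h < K₁ ^ 2 / 2 := by
    refine ⟨Real.sqrt (realPotential m y + h + K ^ 2 / 2), Real.sqrt_nonneg _, ?_, ?_⟩ <;>
    · rw [Real.sq_sqrt (by positivity)]; linarith
  have hev : ∀ᶠ z in 𝓝 y, z ∈ collisionFree E N ∧ realPotential m z + h < K₁ ^ 2 / 2 :=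
    (isOpen_collisionFree.eventually_mem hy).and
      (((continuousAt_realPotential m hy).add_const h).eventually_lt_const hK₁)
  obtain ⟨r, hr, hball⟩ := Metric.nhds_basis_closedBall.eventually_iff.1 hev
  have hcomp : IsCompact (Metric.closedBall y r) := isCompact_closedBall y r
  have hyS : y ∈ Metric.closedBall y r := Metric.mem_closedBall_self hr.le
  obtain ⟨zM, -, hM⟩ := hcomp.exists_isMaxOn ⟨y, hyS⟩ hu.continuousOn
  have hMy : u y ≤ u zM := hM hyS
  -- `B` is so large that the maximum is not on the boundary of the ball
  obtain ⟨B, hB0, hB⟩ : ∃ B : ℝ, 0 ≤ B ∧ ∀ z : Fin N → E, dist z y = r →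
      u zM - u y + 1 ≤ B * massNormSq m (z - y) := by
    refine ⟨(u zM - u y + 1) * c / r ^ 2, by
      have : 0 ≤ u zM - u y + 1 := by linarith
      positivity, fun z hz => ?_⟩
    have h1 := hcQ (z - y)
    rw [← dist_eq_norm, hz] at h1
    have h2 : 1 ≤ c * massNormSq m (z - y) / r ^ 2 := (one_le_div (by positivity)).2 h1
    calc u zM - u y + 1 ≤ (u zM - u y + 1) * (c * massNormSq m (z - y) / r ^ 2) :=
          le_mul_of_one_le_right (by linarith) h2
      _ = _ := by ring
  have key : ∀ ε : ℝ, 0 < ε → ∃ x : Fin N → E,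
      ‖x - y‖ ^ 2 ≤ c * (K₁ ^ 2 / (K ^ 2 - K₁ ^ 2)) * ε ^ 2 ∧
      ∀ z ∈ Metric.closedBall y r, u z ≤ conicalTest m K B ε y z + u x := by
    intro ε hε
    have hφ := contDiff_conicalTest hm K B hε y
    obtain ⟨x, hxS, hx⟩ := hcomp.exists_isMaxOn ⟨y, hyS⟩
      (hu.sub hφ.continuous).continuousOn
    have hφ0 : ∀ z, K * ε + B * massNormSq m (z - y) ≤ conicalTest m K B ε y z := by
      intro z
      refine add_le_add_left (mul_le_mul_of_nonneg_left (Real.le_sqrt_of_sq_le ?_) hK0.le) _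
      linarith [massNormSq_nonneg hm (z - y)]
    have hφy : conicalTest m K B ε y y = K * ε := by
      simp [conicalTest, Real.sqrt_sq hε.le]
    have hxlt : dist x y < r := by
      refine lt_of_le_of_ne hxS fun hxr => ?_
      have h1 : u y - conicalTest m K B ε y y ≤ u x - conicalTest m K B ε y x := hx hyS
      have h2 : u x ≤ u zM := hM hxS
      linarith [hφ0 x, hB x hxr]
    have hloc : IsLocalMax (fun z => u z - conicalTest m K B ε y z) x := by
      filter_upwards [Metric.isOpen_ball.mem_nhds (Metric.mem_ball.2 hxlt)] with z hz
      exact hx (Metric.ball_subset_closedBall hz)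
    obtain ⟨hxΩ, hxU⟩ := hball hxS
    have hdual := massDualNorm_sq_le_of_hamiltonian_le hm hxΩ (hs _ hφ x hloc)
    set p := fderiv ℝ (conicalTest m K B ε y) x with hp
    have hpK : massDualNorm m p ≤ K₁ := by
      refine le_of_lt (lt_of_pow_lt_pow_left₀ 2 hK₁0 ?_)
      linarith
    set q := massNormSq m (x - y) with hq
    have hq0 : 0 ≤ q := massNormSq_nonneg hm _
    have hbound : K ^ 2 * q ≤ K₁ ^ 2 * (q + ε ^ 2) := by
      rcases hq0.eq_or_lt with h0 | hqpos
      · rw [← h0, mul_zero]; positivity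
      have hsq : 0 < Real.sqrt q := Real.sqrt_pos.2 hqpos
      have hD : 0 < Real.sqrt (q + ε ^ 2) := Real.sqrt_pos.2 (by positivity)
      have hv : massNormSq m ((Real.sqrt q)⁻¹ • (x - y)) ≤ 1 := by
        rw [massNormSq_smul, inv_pow, Real.sq_sqrt hq0, ← hq, inv_mul_cancel₀ hqpos.ne']
      have h1 := (le_massDualNorm hm p hv).trans hpK
      rw [map_smul, hp, fderiv_conicalTest_radial hm K B hε, ← hq, smul_eq_mul] at h1
      have h2 : K * (Real.sqrt q / Real.sqrt (q + ε ^ 2)) ≤ K₁ := by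
        refine le_trans ?_ h1
        have e1 : (Real.sqrt q)⁻¹ * (K * (q / Real.sqrt (q + ε ^ 2)))
            = K * (Real.sqrt q / Real.sqrt (q + ε ^ 2)) := by
          field_simp
          rw [Real.sq_sqrt hq0]
        rw [mul_add, e1]
        have : 0 ≤ (Real.sqrt q)⁻¹ * (B * (2 * q)) := by positivity
        linarith
      rw [← mul_div_assoc, div_le_iff₀ hD] at h2
      have h3 := pow_le_pow_left₀ (by positivity) h2 2
      rwa [mul_pow, mul_pow, Real.sq_sqrt hq0, Real.sq_sqrt (by positivity)] at h3
    refine ⟨x, ?_, fun z hz => ?_⟩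
    · have hpos : 0 < K ^ 2 - K₁ ^ 2 := by linarith
      have : q ≤ K₁ ^ 2 / (K ^ 2 - K₁ ^ 2) * ε ^ 2 := by
        rw [div_mul_eq_mul_div, le_div_iff₀ hpos]; linarith
      calc ‖x - y‖ ^ 2 ≤ c * q := hcQ _
        _ ≤ _ := by rw [mul_assoc]; exact mul_le_mul_of_nonneg_left this hc.le
    · have h1 : u z - conicalTest m K B ε y z ≤ u x - conicalTest m K B ε y x := hx hz
      have h2 := hφ0 x
      have : 0 ≤ K * ε + B * massNormSq m (x - y) := by positivity
      linarith
  choose! X hX using key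
  have hXy : Tendsto X (𝓝[>] 0) (𝓝 y) := by
    rw [tendsto_iff_norm_sub_tendsto_zero]
    have hz : Tendsto (fun ε : ℝ => c * (K₁ ^ 2 / (K ^ 2 - K₁ ^ 2)) * ε ^ 2) (𝓝[>] 0) (𝓝 0) := by
      have : Continuous fun ε : ℝ => c * (K₁ ^ 2 / (K ^ 2 - K₁ ^ 2)) * ε ^ 2 := by fun_prop
      simpa using (this.tendsto 0).mono_left nhdsWithin_le_nhds
    have hsq : Tendsto (fun ε => ‖X ε - y‖ ^ 2) (𝓝[>] 0) (𝓝 0) :=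
      tendsto_of_tendsto_of_tendsto_of_le_of_le' tendsto_const_nhds hz
        (Eventually.of_forall fun _ => sq_nonneg _)
        (by filter_upwards [self_mem_nhdsWithin] with ε hε using (hX ε hε).1)
    simpa [Real.sqrt_sq] using hsq.sqrt
  refine ⟨B, ?_⟩
  filter_upwards [Metric.closedBall_mem_nhds y hr] with z hz
  have hlim : Tendsto (fun ε => conicalTest m K B ε y z + u (X ε)) (𝓝[>] 0)
      (𝓝 (K * Real.sqrt (massNormSq m (z - y)) + B * massNormSq m (z - y) + u y)) := by
    refine Tendsto.add ?_ ((hu.tendsto y).comp hXy)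
    have : Continuous fun ε : ℝ => conicalTest m K B ε y z := by
      unfold conicalTest; fun_prop
    simpa [conicalTest] using (this.tendsto 0).mono_left nhdsWithin_le_nhds
  have := ge_of_tendsto hlim (by
    filter_upwards [self_mem_nhdsWithin] with ε hε using (hX ε hε).2 z hz)
  linarith

/-- The Lagrangian plus the energy at collision-free configurations, as a real number. -/
noncomputable def realLagrangian (m : Fin N → ℝ) (h : ℝ) (x v : Fin N → E) : ℝ :=
  massNormSq m v / 2 + realPotential m x + h

/-- Viscosity subsolutions are dominated: along a differentiable collision-free curve they grow at
most as fast as any primitive of a function above `L + h`. -/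
lemma IsViscositySubsolution.sub_le_of_hasDerivAt [FiniteDimensional ℝ E]
    {m : Fin N → ℝ} (hm : ∀ i, 0 < m i)
    {h : ℝ} (hh : 0 ≤ h) {u : (Fin N → E) → ℝ} (hu : Continuous u)
    (hs : IsViscositySubsolution m h u) {s t : ℝ} (hst : s ≤ t) {η η' : ℝ → Fin N → E}
    {Φ Φ' : ℝ → ℝ} (hη : ∀ τ ∈ Set.Icc s t, HasDerivAt η (η' τ) τ)
    (hΩ : ∀ τ ∈ Set.Icc s t, η τ ∈ collisionFree E N)
    (hΦ : ∀ τ ∈ Set.Icc s t, HasDerivAt Φ (Φ' τ) τ)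
    (hle : ∀ τ ∈ Set.Icc s t, realLagrangian m h (η τ) (η' τ) ≤ Φ' τ) :
    u (η t) - u (η s) ≤ Φ t - Φ s := by
  have hηc : ContinuousOn η (Set.Icc s t) := fun τ hτ =>
    (hη τ hτ).continuousAt.continuousWithinAt
  have := image_le_of_liminf_slope_right_le_deriv_boundary (f := fun τ => u (η τ)) (a := s) (b := t)
    (B := fun τ => Φ τ - Φ s + u (η s)) (B' := Φ') (hu.comp_continuousOn hηc) (by simp)
    (fun τ hτ => (((hΦ τ hτ).sub_const _).add_const _).continuousAt.continuousWithinAt)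
    (fun τ hτ => (((hΦ τ (Set.Ico_subset_Icc_self hτ)).sub_const _).add_const _).hasDerivWithinAt)
    ?_ (Set.right_mem_Icc.2 hst)
  · linarith
  intro τ hτ r hr
  have hτ' := Set.Ico_subset_Icc_self hτ
  have hΩτ := hΩ τ hτ'
  have hlt : realLagrangian m h (η τ) (η' τ) < r := (hle τ hτ').trans_lt hr
  rw [realLagrangian] at hlt
  set e := r - (massNormSq m (η' τ) / 2 + realPotential m (η τ) + h) with he
  have he0 : 0 < e := by linarith
  have hU0 := realPotential_nonneg hm (η τ)
  have hQ0 := massNormSq_nonneg hm (η' τ)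
  -- `K * ‖v‖ ≤ K ^ 2 / 2 + ‖v‖ ^ 2 / 2`, with `K ^ 2 / 2` slightly above `U + h`
  set K := Real.sqrt (2 * (realPotential m (η τ) + h) + e) with hKdef
  have hK0 : 0 < K := Real.sqrt_pos.2 (by positivity)
  have hK2 : K ^ 2 = 2 * (realPotential m (η τ) + h) + e := Real.sq_sqrt (by positivity)
  obtain ⟨B, hB⟩ := hs.exists_eventually_sub_le hm hh hu hΩτ hK0 (by rw [hK2]; linarith)
  have hKr : K * Real.sqrt (massNormSq m (η' τ)) < r := by
    have h1 := Real.sq_sqrt hQ0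
    nlinarith [sq_nonneg (K - Real.sqrt (massNormSq m (η' τ)))]
  have hslope : Tendsto (slope η τ) (𝓝[>] τ) (𝓝 (η' τ)) :=
    (hη τ hτ').tendsto_slope.mono_left (nhdsWithin_mono _ fun z hz => ne_of_gt hz)
  have hQs : Tendsto (fun z => massNormSq m (slope η τ z)) (𝓝[>] τ) (𝓝 (massNormSq m (η' τ))) :=
    ((continuous_massNormSq m).tendsto _).comp hslope
  have hz0 : Tendsto (fun z : ℝ => z - τ) (𝓝[>] τ) (𝓝 0) := by
    have : Continuous fun z : ℝ => z - τ := by fun_prop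
    simpa using (this.tendsto τ).mono_left nhdsWithin_le_nhds
  have hlim : Tendsto (fun z => K * Real.sqrt (massNormSq m (slope η τ z))
      + B * massNormSq m (slope η τ z) * (z - τ)) (𝓝[>] τ)
      (𝓝 (K * Real.sqrt (massNormSq m (η' τ)))) := by
    simpa using (hQs.sqrt.const_mul K).add ((hQs.const_mul B).mul hz0)
  refine Eventually.frequently ?_
  filter_upwards [hlim.eventually_lt_const hKr, self_mem_nhdsWithin,
    ((hη τ hτ').continuousAt.tendsto.mono_left nhdsWithin_le_nhds).eventually hB] with z h1 h2 h3
  refine lt_of_le_of_lt ?_ h1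
  have hz : 0 < z - τ := sub_pos.2 h2
  have hsm : η z - η τ = (z - τ) • slope η τ z := (sub_smul_slope η τ z).symm
  rw [hsm, massNormSq_smul, Real.sqrt_mul (sq_nonneg _), Real.sqrt_sq hz.le] at h3
  rw [slope_def_field, div_le_iff₀ hz]
  nlinarith

/-! ### Calibrated rays and domination in reversed time -/

lemma realLagrangian_neg (m : Fin N → ℝ) (h : ℝ) (x v : Fin N → E) :
    realLagrangian m h x (-v) = realLagrangian m h x v := by
  simp [realLagrangian, massNormSq]

/-- The time reversal `y` of a calibrating curve of `u` with limit shape `a`, the calibration being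
expressed in differential form: `(u ∘ y)' = -(L + h)`. -/
structure IsCalibratedRay (m : Fin N → ℝ) (h : ℝ) (a : Fin N → E) (u : (Fin N → E) → ℝ)
    (y : ℝ → Fin N → E) : Prop where
  collisionFree : ∀ r, 0 < r → y r ∈ collisionFree E N
  hasDerivAt : ∀ r, 0 < r → HasDerivAt y (deriv y r) r
  calibrated : ∀ r, 0 < r →
    HasDerivAt (fun s => u (y s)) (-realLagrangian m h (y r) (deriv y r)) r
  isLittleO : (fun t => y t - t • a) =o[atTop] fun t : ℝ => t
  tendsto_zero : Tendsto y (𝓝[>] 0) (𝓝 (y 0))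

lemma action_eq_ofReal_integral {m : Fin N → ℝ} (hm : ∀ i, 0 < m i) {h : ℝ} (hh : 0 ≤ h)
    {γ : ℝ → Fin N → E} {s t : ℝ} (hst : s ≤ t) (hΩ : ∀ τ ∈ Set.Icc s t, γ τ ∈ collisionFree E N)
    (hc : ContinuousOn (fun τ => realLagrangian m h (γ τ) (deriv γ τ)) (Set.Icc s t)) :
    action m h γ s t
      = ENNReal.ofReal (∫ τ in s..t, realLagrangian m h (γ τ) (deriv γ τ)) := by
  have hQ := fun v : Fin N → E => massNormSq_nonneg hm v
  have hU := fun x : Fin N → E => realPotential_nonneg hm x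
  have h0 : ∀ τ, 0 ≤ realLagrangian m h (γ τ) (deriv γ τ) := fun τ => by
    unfold realLagrangian; linarith [hQ (deriv γ τ), hU (γ τ)]
  rw [intervalIntegral.integral_of_le hst, ← integral_Icc_eq_integral_Ioc,
    ofReal_integral_eq_lintegral_ofReal hc.integrableOn_Icc (Eventually.of_forall h0), action]
  refine setLIntegral_congr_fun measurableSet_Icc fun τ hτ => ?_
  have h1 := hQ (deriv γ τ)
  have h2 := hU (γ τ)
  simp only [lagrangian, realLagrangian, potential_eq hm (hΩ τ hτ)]
  rw [ENNReal.ofReal_add (by positivity) hh, ENNReal.ofReal_add (by positivity) h2]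

lemma IsCalibrating.isCalibratedRay {m : Fin N → ℝ} (hm : ∀ i, 0 < m i) {h : ℝ} (hh : 0 ≤ h)
    {a : Fin N → E} {u : (Fin N → E) → ℝ} {γ : ℝ → Fin N → E} (hγ : IsCalibrating m h u γ)
    (hmot : IsHyperbolicMotion m 0 (fun t => γ (-t)) a) :
    IsCalibratedRay m h a u fun t => γ (-t) := by
  obtain ⟨-, hsol, hasym⟩ := hmot
  have hdy : ∀ r : ℝ, deriv (fun t => γ (-t)) r = -deriv γ (-r) := fun r => deriv_comp_neg γ r
  have hΩ : ∀ τ : ℝ, τ < 0 → γ τ ∈ collisionFree E N := fun τ hτ => by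
    simpa using (hsol (-τ) (neg_pos.2 hτ)).1
  have hdγ : ∀ τ : ℝ, τ < 0 → HasDerivAt γ (deriv γ τ) τ := fun τ hτ => by
    have h1 := (hsol (-τ) (neg_pos.2 hτ)).2.1.hasDerivAt
    have h2 := h1.scomp τ (hasDerivAt_neg τ)
    have h3 : ((fun t => γ (-t)) ∘ Neg.neg) = γ := by funext t; simp
    rw [h3] at h2
    exact h2.differentiableAt.hasDerivAt
  have hcd : ∀ τ : ℝ, τ < 0 → ContinuousAt (deriv γ) τ := fun τ hτ => by
    have h1 := (hsol (-τ) (neg_pos.2 hτ)).2.2.continuousAt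
    have h2 : ContinuousAt (fun s => -deriv (fun t => γ (-t)) (-s)) τ :=
      (ContinuousAt.comp (f := fun s : ℝ => -s) h1 continuousAt_neg).neg
    have h3 : (fun s => -deriv (fun t => γ (-t)) (-s)) = deriv γ := by
      funext s; rw [hdy]; simp
    rwa [h3] at h2
  have hcl : ∀ τ : ℝ, τ < 0 →
      ContinuousAt (fun τ => realLagrangian m h (γ τ) (deriv γ τ)) τ := fun τ hτ => by
    unfold realLagrangian
    refine ((ContinuousAt.div_const ?_ 2).add ?_).add continuousAt_const
    · exact (continuous_massNormSq m).continuousAt.comp (hcd τ hτ)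
    · exact ContinuousAt.comp (f := γ) (continuousAt_realPotential m (hΩ τ hτ))
        (hdγ τ hτ).continuousAt
  have hcon : ContinuousOn (fun τ => realLagrangian m h (γ τ) (deriv γ τ)) (Set.Iio 0) :=
    fun τ hτ => (hcl τ hτ).continuousWithinAt
  have hint : ∀ s t : ℝ, s ≤ t → t < 0 →
      u (γ t) - u (γ s) = ∫ τ in s..t, realLagrangian m h (γ τ) (deriv γ τ) := by
    intro s t hst ht
    have hsub : Set.Icc s t ⊆ Set.Iio 0 := fun τ hτ => lt_of_le_of_lt hτ.2 ht
    have h1 := (hγ s t hst ht.le).2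
    have h0 : 0 ≤ ∫ τ in s..t, realLagrangian m h (γ τ) (deriv γ τ) :=
      intervalIntegral.integral_nonneg hst fun τ _ => by
        unfold realLagrangian
        linarith [massNormSq_nonneg hm (deriv γ τ), realPotential_nonneg hm (γ τ)]
    rw [action_eq_ofReal_integral hm hh hst (fun τ hτ => hΩ τ (hsub hτ)) (hcon.mono hsub),
      EReal.coe_ennreal_ofReal, max_eq_left h0, EReal.coe_eq_coe_iff] at h1
    exact h1
  have hcal : ∀ r : ℝ, r < 0 →
      HasDerivAt (fun τ => u (γ τ)) (realLagrangian m h (γ r) (deriv γ r)) r := by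
    intro r hr
    have hsub : Set.uIcc (r - 1) r ⊆ Set.Iio 0 := by
      rw [Set.uIcc_of_le (by linarith)]
      exact fun τ hτ => lt_of_le_of_lt hτ.2 hr
    have h1 := intervalIntegral.integral_hasDerivAt_right (hcon.mono hsub).intervalIntegrable
      (hcon.stronglyMeasurableAtFilter isOpen_Iio r hr) (hcl r hr)
    refine (h1.const_add (u (γ (r - 1)))).congr_of_eventuallyEq ?_
    filter_upwards [Ioo_mem_nhds (sub_one_lt r) hr] with τ hτ
    linarith [hint (r - 1) τ hτ.1.le hτ.2]
  refine ⟨fun r hr => (hsol r hr).1, fun r hr => (hsol r hr).2.1.hasDerivAt, fun r hr => ?_,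
    hasym, ?_⟩
  · have h1 := (hcal (-r) (neg_neg_of_pos hr)).scomp r (hasDerivAt_neg r)
    rw [hdy, realLagrangian_neg]
    simpa [Function.comp_def] using h1
  · have h1 := (hγ (-1) 0 (by norm_num) le_rfl).1.continuousOn
    rw [Set.uIcc_of_le (by norm_num)] at h1
    have h2 : Tendsto (fun r : ℝ => -r) (𝓝[>] 0) (𝓝[Set.Icc (-1) 0] 0) := by
      refine tendsto_nhdsWithin_iff.2 ⟨?_, ?_⟩
      · simpa using (continuous_neg.tendsto (0 : ℝ)).mono_left nhdsWithin_le_nhds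
      · filter_upwards [Ioo_mem_nhdsGT (zero_lt_one' ℝ)] with r hr
        exact ⟨by linarith [hr.2], by linarith [hr.1]⟩
    have h3 := (h1 0 (by norm_num)).tendsto.comp h2
    simpa [Function.comp_def] using h3

/-- Domination for a curve run backwards in time. -/
lemma IsViscositySubsolution.sub_le_of_hasDerivAt_reverse [FiniteDimensional ℝ E]
    {m : Fin N → ℝ} (hm : ∀ i, 0 < m i) {h : ℝ} (hh : 0 ≤ h) {u : (Fin N → E) → ℝ}
    (hu : Continuous u) (hs : IsViscositySubsolution m h u) {s t : ℝ} (hst : s ≤ t)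
    {η η' : ℝ → Fin N → E} {Φ Φ' : ℝ → ℝ} (hη : ∀ τ ∈ Set.Icc s t, HasDerivAt η (η' τ) τ)
    (hΩ : ∀ τ ∈ Set.Icc s t, η τ ∈ collisionFree E N)
    (hΦ : ∀ τ ∈ Set.Icc s t, HasDerivAt Φ (Φ' τ) τ)
    (hle : ∀ τ ∈ Set.Icc s t, realLagrangian m h (η τ) (η' τ) ≤ Φ' τ) :
    u (η s) - u (η t) ≤ Φ t - Φ s := by
  have hmem : ∀ τ ∈ Set.Icc (-t) (-s), -τ ∈ Set.Icc s t := fun τ hτ =>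
    ⟨by linarith [hτ.2], by linarith [hτ.1]⟩
  have := hs.sub_le_of_hasDerivAt hm hh hu (neg_le_neg hst) (η := fun τ => η (-τ))
    (η' := fun τ => -η' (-τ)) (Φ := fun τ => -Φ (-τ)) (Φ' := fun τ => Φ' (-τ))
    (fun τ hτ => by
      simpa [Function.comp_def] using (hη _ (hmem τ hτ)).scomp τ (hasDerivAt_neg τ))
    (fun τ hτ => hΩ _ (hmem τ hτ))
    (fun τ hτ => by
      simpa [Function.comp_def] using ((hΦ _ (hmem τ hτ)).scomp τ (hasDerivAt_neg τ)).fun_neg)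
    (fun τ hτ => by rw [realLagrangian_neg]; exact hle _ (hmem τ hτ))
  simp only [neg_neg] at this
  linarith

/-- Along a calibrated ray of `u`, another subsolution `v` varies less than `u`; the starting point
of the ray may have collisions. -/
lemma IsCalibratedRay.sub_le_sub [FiniteDimensional ℝ E] {m : Fin N → ℝ} (hm : ∀ i, 0 < m i)
    {h : ℝ} (hh : 0 ≤ h) {a : Fin N → E} {u v : (Fin N → E) → ℝ} {y : ℝ → Fin N → E}
    (hy : IsCalibratedRay m h a u y) (hu : Continuous u) (hv : Continuous v)
    (hs : IsViscositySubsolution m h v) {t : ℝ} (ht : 0 < t) :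
    v (y 0) - v (y t) ≤ u (y 0) - u (y t) := by
  have hlim : ∀ f : (Fin N → E) → ℝ, Continuous f →
      Tendsto (fun s => f (y s) - f (y t)) (𝓝[>] 0) (𝓝 (f (y 0) - f (y t))) := fun f hf =>
    ((hf.tendsto _).comp hy.tendsto_zero).sub_const _
  refine le_of_tendsto_of_tendsto (hlim v hv) (hlim u hu) ?_
  filter_upwards [Ioo_mem_nhdsGT ht] with s hst
  have hpos : ∀ τ ∈ Set.Icc s t, 0 < τ := fun τ hτ => hst.1.trans_le hτ.1
  have := hs.sub_le_of_hasDerivAt_reverse hm hh hv hst.2.le (η := y) (η' := deriv y)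
    (Φ := fun τ => -u (y τ)) (fun τ hτ => hy.hasDerivAt τ (hpos τ hτ))
    (fun τ hτ => hy.collisionFree τ (hpos τ hτ))
    (fun τ hτ => (hy.calibrated τ (hpos τ hτ)).neg) (fun τ _ => (neg_neg _).ge)
  linarith

/-! ### Comparison far away along rays with the same limit shape -/

lemma IsCalibratedRay.tendsto_mean_velocity {m : Fin N → ℝ} {h : ℝ} {a : Fin N → E}
    {u : (Fin N → E) → ℝ} {y : ℝ → Fin N → E} (hy : IsCalibratedRay m h a u y) (t : ℝ) :
    Tendsto (fun T : ℝ => T⁻¹ • (y (t + T) - y t)) atTop (𝓝 a) := by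
  have h1 : Tendsto (fun T : ℝ => t + T) atTop atTop := tendsto_atTop_add_const_left _ _ tendsto_id
  have h2 : (fun T : ℝ => t + T) =O[atTop] fun T : ℝ => T := by
    refine Asymptotics.IsBigO.add ?_ (Asymptotics.isBigO_refl _ _)
    exact (Asymptotics.isLittleO_const_id_atTop t).isBigO
  have h3 : Tendsto (fun T : ℝ => T⁻¹ • (y (t + T) - (t + T) • a)) atTop (𝓝 0) :=
    ((hy.isLittleO.comp_tendsto h1).trans_isBigO h2).tendsto_inv_smul_nhds_zero
  have h4 : Tendsto (fun T : ℝ => T⁻¹ • (t • a - y t)) atTop (𝓝 0) := by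
    simpa using (tendsto_inv_atTop_zero (𝕜 := ℝ)).smul_const (t • a - y t)
  have h5 := (h3.add h4).add_const a
  rw [add_zero, zero_add] at h5
  refine h5.congr' ?_
  filter_upwards [eventually_gt_atTop 0] with T hT
  have e1 : T⁻¹ • (T • a) = a := by rw [smul_smul, inv_mul_cancel₀ hT.ne', one_smul]
  have e2 : y (t + T) - y t = y (t + T) - (t + T) • a + (t • a - y t) + T • a := by
    rw [add_smul]; abel
  rw [e2, smul_add, smul_add, e1]

/-- The main estimate. The ray `y` is deformed on `[t, t + T]` by adding an affine multiple of
`δ = z - y t`, so that it starts at `z`. As the curves remain in a cone around the ray through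
`a`, the potential changes by at most `C * ‖δ‖ / s ^ 2` at time `s`, in total by at most
`C * ‖δ‖ / t`, and the change of the kinetic term tends to `-⟪a, δ⟫` as `T → ∞`. -/
lemma IsCalibratedRay.exists_sub_le [FiniteDimensional ℝ E] {m : Fin N → ℝ} (hm : ∀ i, 0 < m i)
    {h : ℝ} (hh : 0 ≤ h) {a : Fin N → E} (ha : a ∈ NBody.collisionFree E N)
    {u : (Fin N → E) → ℝ} {y : ℝ → Fin N → E}
    (hy : IsCalibratedRay m h a u y) (hu : Continuous u) (hs : IsViscositySubsolution m h u) :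
    ∃ C κ : ℝ, 0 < κ ∧ ∀ᶠ t : ℝ in atTop, ∀ z : Fin N → E, ‖z - y t‖ ≤ κ * t →
      u z - u (y t) ≤ -massInner m a (z - y t) + C * (‖z - y t‖ / t) := by
  obtain ⟨d, hd0, hd⟩ := exists_pos_le_norm_sub ha
  obtain ⟨C, hC0, hC⟩ := exists_realPotential_sub_le hm hd0 hd
  refine ⟨C, d / 8, by positivity, ?_⟩
  obtain ⟨t₀, ht₀⟩ := eventually_atTop.1 (hy.isLittleO.bound (show 0 < d / 8 by positivity))
  filter_upwards [eventually_ge_atTop t₀, eventually_gt_atTop 0] with t htt₀ ht z hz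
  set δ := z - y t with hδ
  have hδ0 : 0 ≤ ‖δ‖ := norm_nonneg _
  have hT : ∀ T : ℝ, 0 < T → u z - u (y t) ≤ -massInner m (T⁻¹ • (y (t + T) - y t)) δ
      + T⁻¹ * massNormSq m δ / 2 + C * (‖δ‖ / t) := by
    intro T hT
    have hmem : ∀ s ∈ Set.Icc t (t + T), 0 < s ∧
        0 ≤ (t + T - s) * T⁻¹ ∧ (t + T - s) * T⁻¹ ≤ 1 := fun s hs => by
      refine ⟨ht.trans_le hs.1, mul_nonneg (by linarith [hs.2]) (by positivity), ?_⟩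
      rw [← div_eq_mul_inv, div_le_one hT]; linarith [hs.1]
    have hcone : ∀ s ∈ Set.Icc t (t + T), ‖y s - s • a‖ ≤ d / 4 * s ∧
        ‖y s + ((t + T - s) * T⁻¹) • δ - s • a‖ ≤ d / 4 * s := by
      intro s hs
      obtain ⟨hs0, h0, h1⟩ := hmem s hs
      have e1 := ht₀ s (htt₀.trans hs.1)
      rw [Real.norm_of_nonneg hs0.le] at e1
      have e2 : ‖((t + T - s) * T⁻¹) • δ‖ ≤ d / 8 * s := by
        rw [norm_smul, Real.norm_of_nonneg h0]
        calc _ ≤ 1 * ‖δ‖ := mul_le_mul_of_nonneg_right h1 hδ0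
          _ ≤ d / 8 * s := by
            rw [one_mul]
            exact hz.trans (mul_le_mul_of_nonneg_left hs.1 (by positivity))
      have e3 : y s + ((t + T - s) * T⁻¹) • δ - s • a
          = (y s - s • a) + ((t + T - s) * T⁻¹) • δ := by abel
      have e4 : 0 ≤ d * s := by positivity
      rw [e3]
      exact ⟨by linarith, (norm_add_le _ _).trans (by linarith)⟩
    have hdom := hs.sub_le_of_hasDerivAt_reverse hm hh hu (show t ≤ t + T by linarith)
      (η := fun s => y s + ((t + T - s) * T⁻¹) • δ)
      (η' := fun s => deriv y s + (-T⁻¹) • δ)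
      (Φ := fun s => -u (y s) - T⁻¹ * massInner m (y s) δ
        + T⁻¹ ^ 2 * massNormSq m δ / 2 * s + C * ‖δ‖ * -s⁻¹)
      (Φ' := fun s => realLagrangian m h (y s) (deriv y s) - T⁻¹ * massInner m (deriv y s) δ
        + T⁻¹ ^ 2 * massNormSq m δ / 2 + C * ‖δ‖ / s ^ 2) ?_ ?_ ?_ ?_
    · have e1 : y t + ((t + T - t) * T⁻¹) • δ = z := by
        rw [add_sub_cancel_left, mul_inv_cancel₀ hT.ne', one_smul, hδ]; abel
      have e2 : y (t + T) + ((t + T - (t + T)) * T⁻¹) • δ = y (t + T) := by simp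
      simp only [e1, e2] at hdom
      have e3 : C * ‖δ‖ * -(t + T)⁻¹ ≤ 0 := by
        have : 0 ≤ C * ‖δ‖ * (t + T)⁻¹ := by positivity
        linarith
      have e4 : T⁻¹ ^ 2 * massNormSq m δ / 2 * (t + T) - T⁻¹ ^ 2 * massNormSq m δ / 2 * t
          = T⁻¹ * massNormSq m δ / 2 := by
        field_simp; ring
      rw [massInner_smul_left, massInner_sub_left]
      have e5 : C * (‖δ‖ / t) = C * ‖δ‖ * t⁻¹ := by ring
      rw [e5]
      linarith
    · intro s hs'
      have e1 : HasDerivAt (fun s : ℝ => (t + T - s) * T⁻¹) (-T⁻¹) s := by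
        simpa using ((hasDerivAt_id s).const_sub (t + T)).mul_const T⁻¹
      exact (hy.hasDerivAt s (hmem s hs').1).add (e1.smul_const δ)
    · intro s hs' i j hij
      have e1 := norm_sub_ge_of_norm_sub_smul_le (hmem s hs').1 hd (hcone s hs').2 hij
      have e2 : 0 < s * d / 2 := by have := (hmem s hs').1; positivity
      exact sub_ne_zero.1 (norm_pos_iff.1 (e2.trans_le e1))
    · intro s hs'
      have hs0 := (hmem s hs').1
      have e1 := (((hy.calibrated s hs0).neg.sub
        ((hasDerivAt_massInner_left m (hy.hasDerivAt s hs0) δ).const_mul T⁻¹)).add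
        ((hasDerivAt_id s).const_mul (T⁻¹ ^ 2 * massNormSq m δ / 2))).add
        ((hasDerivAt_inv hs0.ne').neg.const_mul (C * ‖δ‖))
      simp only [neg_neg, mul_one] at e1
      exact e1
    · intro s hs'
      obtain ⟨hs0, h0, h1⟩ := hmem s hs'
      have e1 := hC s hs0 _ _ (hcone s hs').2 (hcone s hs').1
      have e2 : ‖y s + ((t + T - s) * T⁻¹) • δ - y s‖ ≤ ‖δ‖ := by
        rw [add_sub_cancel_left, norm_smul, Real.norm_of_nonneg h0]
        exact mul_le_of_le_one_left hδ0 h1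
      have e3 : C * ‖y s + ((t + T - s) * T⁻¹) • δ - y s‖ / s ^ 2 ≤ C * ‖δ‖ / s ^ 2 := by gcongr
      simp only [realLagrangian]
      rw [massNormSq_add_smul]
      linarith
  have hlim : Tendsto (fun T : ℝ => -massInner m (T⁻¹ • (y (t + T) - y t)) δ
      + T⁻¹ * massNormSq m δ / 2 + C * (‖δ‖ / t)) atTop
      (𝓝 (-massInner m a δ + C * (‖δ‖ / t))) := by
    have e1 := ((continuous_massInner_left m δ).tendsto a).comp (hy.tendsto_mean_velocity t)
    have e2 := ((tendsto_inv_atTop_zero (𝕜 := ℝ)).mul_const (massNormSq m δ)).div_const 2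
    simpa using (e1.neg.add e2).add_const (C * (‖δ‖ / t))
  refine ge_of_tendsto hlim ?_
  filter_upwards [eventually_gt_atTop 0] with T hT0 using hT T hT0

/-- The difference of two solutions at the starting point of a ray of the first is at most its value
at the starting point of a ray of the second. -/
lemma sub_le_sub_of_isCalibratedRay [FiniteDimensional ℝ E] {m : Fin N → ℝ} (hm : ∀ i, 0 < m i)
    {h : ℝ} (hh : 0 ≤ h) {a : Fin N → E} (ha : a ∈ collisionFree E N)
    {u₁ u₂ : (Fin N → E) → ℝ} (hu₁ : Continuous u₁) (hu₂ : Continuous u₂)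
    (hs₁ : IsViscositySubsolution m h u₁) (hs₂ : IsViscositySubsolution m h u₂)
    {y₁ y₂ : ℝ → Fin N → E} (hy₁ : IsCalibratedRay m h a u₁ y₁)
    (hy₂ : IsCalibratedRay m h a u₂ y₂) :
    u₂ (y₁ 0) - u₁ (y₁ 0) ≤ u₂ (y₂ 0) - u₁ (y₂ 0) := by
  obtain ⟨C₁, κ₁, hκ₁, h₁⟩ := hy₁.exists_sub_le hm hh ha hu₁ hs₁
  obtain ⟨C₂, κ₂, hκ₂, h₂⟩ := hy₂.exists_sub_le hm hh ha hu₂ hs₂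
  have ho : (fun t => y₁ t - y₂ t) =o[atTop] fun t : ℝ => t :=
    (hy₁.isLittleO.sub hy₂.isLittleO).congr_left fun t => by abel
  have hlim : Tendsto (fun t : ℝ => (C₁ + C₂) * (‖y₁ t - y₂ t‖ / t)) atTop (𝓝 0) := by
    simpa using ho.norm_left.tendsto_div_nhds_zero.const_mul (C₁ + C₂)
  have key : ∀ᶠ t : ℝ in atTop, (u₂ (y₁ 0) - u₁ (y₁ 0)) - (u₂ (y₂ 0) - u₁ (y₂ 0))
      ≤ (C₁ + C₂) * (‖y₁ t - y₂ t‖ / t) := by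
    filter_upwards [h₁, h₂, ho.bound hκ₁, ho.bound hκ₂, eventually_gt_atTop 0]
      with t e₁ e₂ b₁ b₂ ht
    rw [Real.norm_of_nonneg ht.le] at b₁ b₂
    have f₁ := e₁ (y₂ t) (by rwa [norm_sub_rev])
    have f₂ := e₂ (y₁ t) b₂
    -- the first-order terms `⟪a, y₁ t - y₂ t⟫` of the two estimates cancel
    rw [← neg_sub (y₁ t) (y₂ t), massInner_neg_right, norm_neg] at f₁
    have g₁ := hy₁.sub_le_sub hm hh hu₁ hu₂ hs₂ ht
    have g₂ := hy₂.sub_le_sub hm hh hu₂ hu₁ hs₁ ht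
    linarith
  exact sub_nonpos.1 (ge_of_tendsto hlim key)

end

end NBody

theorem theorem1 {E : Type*} [NormedAddCommGroup E] [InnerProductSpace ℝ E]
    [FiniteDimensional ℝ E] (hE : 2 ≤ Module.finrank ℝ E)
    {N : ℕ} (m : Fin N → ℝ) (hm : ∀ i, 0 < m i)
    (a : Fin N → E) (ha : a ∈ NBody.collisionFree E N)
    (u₁ u₂ : (Fin N → E) → ℝ)
    (h₁ : u₁ ∈ NBody.solutionSet m a) (h₂ : u₂ ∈ NBody.solutionSet m a) :
    ∃ k : ℝ, ∀ x : Fin N → E, u₂ x = u₁ x + k := by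
  have hh : 0 ≤ NBody.massNormSq m a / 2 := by
    have := NBody.massNormSq_nonneg hm a
    positivity
  have hray : ∀ u ∈ NBody.solutionSet m a, ∀ x : Fin N → E,
      ∃ y, y 0 = x ∧ NBody.IsCalibratedRay m (NBody.massNormSq m a / 2) a u y := by
    intro u hu x
    obtain ⟨γ, hγ0, hγ⟩ := hu.exists_calibrating x
    exact ⟨fun t => γ (-t), by simpa using hγ0, hγ.isCalibratedRay hm hh (hu.hyperbolic γ hγ)⟩
  have hle : ∀ x x' : Fin N → E, u₂ x - u₁ x ≤ u₂ x' - u₁ x' := by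
    intro x x'
    obtain ⟨y₁, rfl, hy₁⟩ := hray u₁ h₁ x
    obtain ⟨y₂, rfl, hy₂⟩ := hray u₂ h₂ x'
    exact NBody.sub_le_sub_of_isCalibratedRay hm hh ha h₁.continuous h₂.continuous
      h₁.subsolution h₂.subsolution hy₁ hy₂
  exact ⟨u₂ 0 - u₁ 0, fun x => by linarith [hle x 0, hle 0 x]⟩
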